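/- Let $N\ge 1$, let $M_{N\times N}$ be the space of complex $N\times N$ matrices, and let $\mathrm{Sym}^2(N)\subset M_{N\times N}$ be the set of invertible symmetric matrices. Let $H_F\subset M_{N\times N}$ be a linear subspace and $\mathrm{Aut}\subset \mathrm{Sym}^2(N)$ a nonempty subset, and let $\dim(\mathrm{Aut})$ be the dimension of its Zariski closure. Assume that either $$\dim(\mathrm{Aut}) < \dim(H_F)-\frac{N(N+1)}{2},$$ or $\mathrm{Aut}$ is stable under multiplication by nonzero complex scalars and $$\dim(\mathrm{Aut}) \le \dim(H_F)-\frac{N(N+1)}{2}.$$ Then there exists $S\in H_F$ such that $\lambda\cdot\operatorname{Spec}(S)\neq\operatorname{Spec}(S)$ for every complex number $\lambda\ne 1$, where $\operatorname{Spec}(S)\subset\mathbb C$ is the set of eigenvalues of $S$, and such that there is no $M\in\mathrm{Aut}$ satisfying $SM=MS^T$. -/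

import Mathlib

/-- The set of invertible symmetric `N × N` complex matrices. -/
def invertibleSymmetric (N : ℕ) : Set (Matrix (Fin N) (Fin N) ℂ) :=
  {M | M.IsSymm ∧ IsUnit M}

/-- The entries of a matrix, as a point of the affine space with coordinates `Fin N × Fin N`. -/
def matrixPoint {N : ℕ} (M : Matrix (Fin N) (Fin N) ℂ) : Fin N × Fin N → ℂ :=
  fun p => M p.1 p.2

/-- The dimension of a set of matrices, that is, the dimension of its Zariski closure in the
affine space of all `N × N` matrices: the Krull dimension of the ring of polynomials in the matrix
entries modulo the ideal of those that vanish on the set. It is `⊥` for the empty set. -/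
noncomputable def matrixSetDim {N : ℕ} (A : Set (Matrix (Fin N) (Fin N) ℂ)) : WithBot ℕ∞ :=
  ringKrullDim (MvPolynomial (Fin N × Fin N) ℂ ⧸
    MvPolynomial.vanishingIdeal ℂ (matrixPoint '' A))

/-- A set of matrices is stable under multiplication by nonzero complex numbers. -/
def IsScalingStable {N : ℕ} (A : Set (Matrix (Fin N) (Fin N) ℂ)) : Prop :=
  ∀ c : ℂ, c ≠ 0 → ∀ M ∈ A, c • M ∈ A

/-!
Write `n = dim H` and `m = N (N + 1) / 2`. The matrix `S` is a generic member of `H`: each of the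
two requirements holds outside the zero set of a nonzero polynomial on `H`.

*No intertwiner.* If `S M = M Sᵀ` with `M` symmetric and invertible, then `S M` is symmetric and
`S = T * adj M` for a symmetric `T`. Such `S` thus lie in the image of `Aut × Sym²`, a variety of
dimension `dim Aut + m`. If this is less than `n`, then `n` coordinate functions on `H` become
algebraically dependent on the source (`AlgebraicIndependent.card_le_ringKrullDim`), which gives the
polynomial (`exists_polynomial_vanishing_of_matrixSetDim_lt`). If `Aut` is stable under scaling, it
may be replaced by its members of determinant one, and `det - 1` is not a zero divisor on `Aut`, so
that the dimension drops by one (`matrixSetDim_det_eq_one_add_one_le`).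

*Spectrum.* A number `c ≠ 1` with `c Spec S = Spec S ≠ {0}` is a root of unity of order at most `N`,
so only finitely many `c` matter, and `c Spec S ⊆ Spec S` means that the matrix `χ_S (c S)` is
nilpotent, a polynomial condition on `S` (`spectrumObstruction_eq_zero_iff`). It remains to find for
each such `c` one member of `H` that violates it (`exists_mul_notMem_spectrum`). Here only `n > m`
is used, which holds since `Aut` is not empty. Let a one-parameter torus with generic weights
degenerate `H` to a space of the same dimension spanned by diagonal matrices and matrix units. The
condition is closed and invariant under conjugation, so it would pass to the limit. The set of
entries of each diagonal matrix there would be mapped into itself by `c`, which allows at most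
`N / 2` independent diagonal matrices (`two_mul_finrank_le_of_mul_mem_range`), and more than `N² / 2`
matrix units would remain. As arcs of a directed graph they contain `i ⇄ j` and `i → k → j`
(`two_mul_sum_le_card_sq_of_path_free`), and a combination of these four matrix units has nonzero
eigenvalues `1` and `-2`, a set not preserved by any `c ≠ 0, 1`.
-/

/-! ### Krull dimension and algebraic independence -/

/-- Prime chains lift along injective integral extensions, by lying over and going up. -/
theorem ringKrullDim_le_of_injective_of_isIntegral {R S : Type*} [CommRing R] [CommRing S]
    [Algebra R S] [Algebra.IsIntegral R S] (hinj : Function.Injective (algebraMap R S)) :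
    ringKrullDim R ≤ ringKrullDim S := by
  refine iSup_le fun l => ?_
  obtain ⟨Q, -, hQ, hQl⟩ := Ideal.exists_ideal_over_prime_of_isIntegral l.head.asIdeal (⊥ : Ideal S)
    (by rw [← RingHom.ker_eq_comap_bot, (RingHom.injective_iff_ker_eq_bot _).mp hinj]; exact bot_le)
  have : Q.LiesOver l.head.asIdeal := ⟨hQl.symm⟩
  obtain ⟨L, hL, -⟩ := Ideal.exists_ltSeries_of_hasGoingUp l Q
  rw [← hL]
  exact le_iSup (fun L : LTSeries (PrimeSpectrum S) => (L.length : WithBot ℕ∞)) L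

/-- The Krull dimension of a finitely generated algebra over a field bounds the number of
algebraically independent elements. The algebra need not be a domain: some prime ideal meets the
polynomial subring only in zero, and Noether normalization is applied to the quotient by it. -/
theorem AlgebraicIndependent.card_le_ringKrullDim {k A : Type} [Field k] [CommRing A] [Algebra k A]
    [Algebra.FiniteType k A] {n : ℕ} {f : Fin n → A} (hf : AlgebraicIndependent k f) :
    (n : WithBot ℕ∞) ≤ ringKrullDim A := by
  let φ : MvPolynomial (Fin n) k →ₐ[k] A := MvPolynomial.aeval f
  have hφ : Function.Injective φ := hf
  obtain ⟨P, hP, hPφ⟩ := Ideal.exists_comap_eq_of_mem_minimalPrimes_of_injective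
    (f := φ.toRingHom) hφ ⊥
    (by rw [IsDomain.minimalPrimes_eq_singleton_bot]; rfl)
  let ψ : MvPolynomial (Fin n) k →ₐ[k] A ⧸ P := (Ideal.Quotient.mkₐ k P).comp φ
  have hψ : Function.Injective ψ := by
    rw [injective_iff_map_eq_zero]
    intro p hp
    have hmem : φ p ∈ P := Ideal.Quotient.eq_zero_iff_mem.mp hp
    have : p ∈ P.comap φ.toRingHom := hmem
    rw [hPφ] at this
    exact this
  obtain ⟨s, g, hg, hgi⟩ := exists_integral_inj_algHom_of_fg k (A ⧸ P)
  have h1 : n ≤ s := by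
    let := g.toRingHom.toAlgebra
    have : IsScalarTower k (MvPolynomial (Fin s) k) (A ⧸ P) :=
      IsScalarTower.of_algebraMap_eq fun x => (g.commutes x).symm
    have : Algebra.IsIntegral (MvPolynomial (Fin s) k) (A ⧸ P) := ⟨hgi⟩
    have : FaithfulSMul (MvPolynomial (Fin s) k) (A ⧸ P) :=
      (faithfulSMul_iff_algebraMap_injective _ _).mpr hg
    have e := trdeg_add_eq k (MvPolynomial (Fin s) k) (A := A ⧸ P)
    rw [trdeg_eq_zero (R := MvPolynomial (Fin s) k) (A := A ⧸ P), add_zero,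
      MvPolynomial.trdeg_of_isDomain] at e
    have e2 := trdeg_le_of_injective ψ hψ
    rw [← e, MvPolynomial.trdeg_of_isDomain] at e2
    simpa using e2
  have h2 : ((s : ℕ) : WithBot ℕ∞) ≤ ringKrullDim (A ⧸ P) := by
    let := g.toRingHom.toAlgebra
    have : Algebra.IsIntegral (MvPolynomial (Fin s) k) (A ⧸ P) := ⟨hgi⟩
    have := ringKrullDim_le_of_injective_of_isIntegral (R := MvPolynomial (Fin s) k) (S := A ⧸ P) hg
    simpa using this
  calc (n : WithBot ℕ∞) ≤ (s : ℕ) := by exact_mod_cast h1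
    _ ≤ ringKrullDim (A ⧸ P) := h2
    _ ≤ ringKrullDim A := ringKrullDim_le_of_surjective _ Ideal.Quotient.mk_surjective

/-! ### Matrices intertwined with their transpose -/

/-- The polynomial map sending a point of an affine variety carrying a matrix `G` of functions,
together with a symmetric matrix `T`, to `T * adj G` satisfies a polynomial relation in any `n`
linear coordinates once `n` exceeds the dimension of the source. -/
theorem exists_polynomial_vanishing_on_symm_mul_adjugate {R : Type} [CommRing R] [Algebra ℂ R]
    [Algebra.FiniteType ℂ R] {N n : ℕ} (G : Matrix (Fin N) (Fin N) R)
    (hdim : ringKrullDim R + ((N * (N + 1) / 2 : ℕ) : WithBot ℕ∞) < (n : WithBot ℕ∞))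
    (π : Matrix (Fin N) (Fin N) ℂ →ₗ[ℂ] (Fin n → ℂ)) :
    ∃ Q : MvPolynomial (Fin n) ℂ, Q ≠ 0 ∧
      ∀ (e : R →ₐ[ℂ] ℂ) (T : Matrix (Fin N) (Fin N) ℂ), T.IsSymm →
        MvPolynomial.eval (π (T * (G.map e).adjugate)) Q = 0 := by
  have : IsNoetherianRing R := Algebra.FiniteType.isNoetherianRing ℂ R
  let GA : Matrix (Fin N) (Fin N) (MvPolynomial (Sym2 (Fin N)) R) := G.map MvPolynomial.C
  let TA : Matrix (Fin N) (Fin N) (MvPolynomial (Sym2 (Fin N)) R) :=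
    Matrix.of fun i j => MvPolynomial.X s(i, j)
  let f : Fin n → MvPolynomial (Sym2 (Fin N)) R := fun l =>
    ∑ i, ∑ j, algebraMap ℂ _ (π (Matrix.single i j 1) l) * (TA * GA.adjugate) i j
  have hdimA : ringKrullDim (MvPolynomial (Sym2 (Fin N)) R) < (n : WithBot ℕ∞) := by
    rw [MvPolynomial.ringKrullDim_of_isNoetherianRing, Nat.card_eq_fintype_card, Sym2.card,
      Fintype.card_fin, Nat.choose_two_right, Nat.add_sub_cancel, mul_comm]
    exact hdim
  have : Algebra.FiniteType ℂ (MvPolynomial (Sym2 (Fin N)) R) :=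
    Algebra.FiniteType.trans (S := R) inferInstance inferInstance
  have hdep : ¬ AlgebraicIndependent ℂ f := fun h => absurd h.card_le_ringKrullDim hdimA.not_ge
  rw [algebraicIndependent_iff] at hdep
  push Not at hdep
  obtain ⟨Q, hQ, hQ0⟩ := hdep
  refine ⟨Q, hQ0, fun e T hT => ?_⟩
  have hT' : ∀ i j, T i j = T j i := fun i j => hT.apply j i
  let ev : MvPolynomial (Sym2 (Fin N)) R →ₐ[ℂ] ℂ :=
    { MvPolynomial.eval₂Hom e.toRingHom (Sym2.lift ⟨fun i j => T i j, hT'⟩) with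
      commutes' := fun r => by
        have : algebraMap ℂ (MvPolynomial (Sym2 (Fin N)) R) r =
          MvPolynomial.C (algebraMap ℂ R r) := rfl
        simp [this] }
  have hevG : GA.map ev = G.map e := by
    ext i j
    exact MvPolynomial.eval₂Hom_C _ _ _
  have hevT : TA.map ev = T := by
    ext i j
    exact MvPolynomial.eval₂Hom_X' _ _ _
  have hevf : (fun l => ev (f l)) = π (T * (G.map e).adjugate) := by
    have hTG : (TA * GA.adjugate).map ev = T * (G.map e).adjugate := by
      have hadj : GA.adjugate.map ev = (GA.map ev).adjugate := ev.map_adjugate GA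
      rw [Matrix.map_mul, hadj, hevG, hevT]
    have hij : ∀ i j, ev ((TA * GA.adjugate) i j) = (T * (G.map e).adjugate) i j := fun i j =>
      congrFun (congrFun hTG i) j
    generalize T * (G.map e).adjugate = S at hij
    funext l
    conv_rhs => rw [Matrix.matrix_eq_sum_single S]
    simp only [f, map_sum, map_mul, hij, AlgHom.commutes, Finset.sum_apply]
    refine Finset.sum_congr rfl fun i _ => Finset.sum_congr rfl fun j _ => ?_
    have : Matrix.single i j (S i j) = S i j • Matrix.single i j (1 : ℂ) := by
      rw [Matrix.smul_single, smul_eq_mul, mul_one]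
    rw [this, map_smul, Pi.smul_apply, smul_eq_mul, mul_comm]
    rfl
  have h0 : ev (MvPolynomial.aeval f Q) = 0 := by rw [hQ, map_zero]
  rw [← AlgHom.comp_apply, MvPolynomial.comp_aeval] at h0
  rw [← hevf]
  exact h0

/-- A matrix `S` with `S M = M Sᵀ` for some invertible symmetric `M` equals `T * adj M` with `T`
symmetric, so such `S` are among the values of a polynomial map on `Aut × Sym²`, whose coordinate
ring has dimension `dim Aut + N (N + 1) / 2`. -/
theorem exists_polynomial_vanishing_of_matrixSetDim_lt {N n : ℕ}
    {Aut : Set (Matrix (Fin N) (Fin N) ℂ)} (hAut : Aut ⊆ invertibleSymmetric N)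
    (hdim : matrixSetDim Aut + ((N * (N + 1) / 2 : ℕ) : WithBot ℕ∞) < (n : WithBot ℕ∞))
    (π : Matrix (Fin N) (Fin N) ℂ →ₗ[ℂ] (Fin n → ℂ)) :
    ∃ Q : MvPolynomial (Fin n) ℂ, Q ≠ 0 ∧
      ∀ S, (∃ M ∈ Aut, S * M = M * S.transpose) → MvPolynomial.eval (π S) Q = 0 := by
  let I := MvPolynomial.vanishingIdeal ℂ (matrixPoint '' Aut)
  obtain ⟨Q, hQ0, hQ⟩ := exists_polynomial_vanishing_on_symm_mul_adjugate
    (R := MvPolynomial (Fin N × Fin N) ℂ ⧸ I)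
    (Matrix.of fun i j => Ideal.Quotient.mk I (MvPolynomial.X (i, j))) hdim π
  refine ⟨Q, hQ0, ?_⟩
  rintro S ⟨M, hM, hSM⟩
  obtain ⟨hMs, hMu⟩ := hAut hM
  have hdet : M.det ≠ 0 := by
    rw [Matrix.isUnit_iff_isUnit_det] at hMu
    exact hMu.ne_zero
  have hSMs : (S * M).IsSymm := by
    rw [Matrix.IsSymm, Matrix.transpose_mul, hMs.eq, hSM]
  have hS : (M.det⁻¹ • (S * M)) * M.adjugate = S := by
    simp [Matrix.mul_assoc, Matrix.mul_adjugate, smul_smul, hdet]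
  have key := hQ (Ideal.Quotient.liftₐ I (MvPolynomial.aeval (matrixPoint M))
    fun p hp => hp _ ⟨M, hM, rfl⟩) (M.det⁻¹ • (S * M)) (hSMs.smul _)
  have hG : (Matrix.of fun i j => Ideal.Quotient.mk I (MvPolynomial.X (i, j))).map
      (Ideal.Quotient.liftₐ I (MvPolynomial.aeval (matrixPoint M))
        fun p hp => hp _ ⟨M, hM, rfl⟩) = M := by
    ext i j
    exact MvPolynomial.aeval_X _ _
  rwa [hG, hS] at key

/-- For a cone of matrices, `det - 1` is not a zero divisor on the cone: a polynomial that vanishes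
where `det ≠ 1` vanishes on all but finitely many points of each line of the cone. Hence cutting by
`det = 1` lowers the dimension. -/
theorem matrixSetDim_det_eq_one_add_one_le {N : ℕ} (hN : 1 ≤ N)
    {Aut : Set (Matrix (Fin N) (Fin N) ℂ)} (hst : IsScalingStable Aut) :
    matrixSetDim {M ∈ Aut | M.det = 1} + 1 ≤ matrixSetDim Aut := by
  have : Nonempty (Fin N) := ⟨⟨0, hN⟩⟩
  let I := MvPolynomial.vanishingIdeal ℂ (matrixPoint '' Aut)
  let J := MvPolynomial.vanishingIdeal ℂ (matrixPoint '' {M ∈ Aut | M.det = 1})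
  have hIJ : I ≤ J := MvPolynomial.vanishingIdeal_anti_mono
    (Set.image_mono fun _ h => h.1)
  let δ : MvPolynomial (Fin N × Fin N) ℂ := (Matrix.mvPolynomialX (Fin N) (Fin N) ℂ).det - 1
  have hδ : ∀ M : Matrix (Fin N) (Fin N) ℂ,
      MvPolynomial.aeval (matrixPoint M) δ = M.det - 1 := by
    intro M
    rw [map_sub, map_one, AlgHom.map_det]
    congr 2
    ext i j
    simp [matrixPoint]
  refine ringKrullDim_succ_le_of_surjective (Ideal.Quotient.factor hIJ)
    (Ideal.Quotient.factor_surjective hIJ) (r := Ideal.Quotient.mk I δ) ?_ ?_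
  · rw [mem_nonZeroDivisors_iff_right]
    intro x hx
    obtain ⟨g, rfl⟩ := Ideal.Quotient.mk_surjective x
    rw [← map_mul, Ideal.Quotient.eq_zero_iff_mem] at hx
    rw [Ideal.Quotient.eq_zero_iff_mem]
    rintro _ ⟨M, hM, rfl⟩
    -- Restriction of polynomials to the line through `M`.
    let ρ : MvPolynomial (Fin N × Fin N) ℂ →ₐ[ℂ] Polynomial ℂ :=
      MvPolynomial.aeval fun p => Polynomial.C (matrixPoint M p) * Polynomial.X
    have hρ : ∀ (p : MvPolynomial (Fin N × Fin N) ℂ) (t : ℂ),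
        (ρ p).eval t = MvPolynomial.aeval (matrixPoint (t • M)) p := by
      intro p t
      have : (Polynomial.aeval t).comp ρ = MvPolynomial.aeval (matrixPoint (t • M)) := by
        ext q
        rw [AlgHom.comp_apply, MvPolynomial.aeval_X, MvPolynomial.aeval_X, map_mul,
          Polynomial.aeval_X, Polynomial.aeval_C]
        exact mul_comm _ _
      rw [← this, AlgHom.comp_apply, Polynomial.coe_aeval_eq_eval]
    have hprod : ρ (g * δ) = 0 := by
      refine Polynomial.eq_zero_of_infinite_isRoot _ (Set.Infinite.mono ?_
        (Set.finite_singleton (0 : ℂ)).infinite_compl)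
      intro t ht
      change (ρ (g * δ)).eval t = 0
      rw [hρ]
      exact hx _ ⟨t • M, hst t ht M hM, rfl⟩
    have hδ0 : ρ δ ≠ 0 := by
      intro h
      have h1 := hρ δ 0
      rw [h, hδ, Polynomial.eval_zero, zero_smul, Matrix.det_zero, zero_sub] at h1
      exact one_ne_zero (neg_eq_zero.mp h1.symm)
    rw [map_mul] at hprod
    have hg := (mul_eq_zero.mp hprod).resolve_right hδ0
    have := hρ g 1
    rw [hg, one_smul] at this
    simpa using this.symm
  · rw [Ideal.Quotient.factor_mk, Ideal.Quotient.eq_zero_iff_mem]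
    rintro _ ⟨M, hM, rfl⟩
    rw [hδ, hM.2, sub_self]

/-! ### Invariance of the spectrum under a scalar as a polynomial condition -/

/-- A matrix with polynomial entries in `c` and `S` that vanishes exactly when the spectrum of the
complex matrix `S` is mapped into itself by multiplication with `c`: the eigenvalues of
`χ_S (c S)` are the numbers `χ_S (c z)`, with `z` an eigenvalue of `S`. -/
noncomputable def spectrumObstruction {N : ℕ} {R : Type*} [CommRing R] (c : R)
    (S : Matrix (Fin N) (Fin N) R) : Matrix (Fin N) (Fin N) R :=
  (Polynomial.aeval (c • S) S.charpoly) ^ N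

theorem spectrumObstruction_map {N : ℕ} {R R' : Type*} [CommRing R] [CommRing R'] (φ : R →+* R')
    (c : R) (S : Matrix (Fin N) (Fin N) R) :
    (spectrumObstruction c S).map φ = spectrumObstruction (φ c) (S.map φ) := by
  have h := Polynomial.map_aeval_eq_aeval_map (φ := φ)
    (ψ := (φ.mapMatrix : Matrix (Fin N) (Fin N) R →+* Matrix (Fin N) (Fin N) R'))
    (by
      ext r i j
      simp [Matrix.algebraMap_matrix_apply, apply_ite φ]) S.charpoly (c • S)
  have hc : φ.mapMatrix (c • S) = φ c • S.map φ := by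
    ext i j
    simp
  rw [spectrumObstruction, spectrumObstruction, ← RingHom.mapMatrix_apply, map_pow, h, hc,
    Matrix.charpoly_map]

theorem pow_eq_zero_of_spectrum_subset {N : ℕ} {B : Matrix (Fin N) (Fin N) ℂ}
    (hB : ∀ z ∈ spectrum ℂ B, z = 0) : B ^ N = 0 := by
  have hroots : B.charpoly.roots = Multiset.replicate N 0 := by
    rw [Multiset.eq_replicate]
    refine ⟨?_, fun z hz => hB z ?_⟩
    · rw [IsAlgClosed.card_roots_eq_natDegree, Matrix.charpoly_natDegree_eq_dim, Fintype.card_fin]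
    · rw [Matrix.mem_spectrum_iff_isRoot_charpoly]
      exact (Polynomial.mem_roots'.mp hz).2
  have hχ : B.charpoly = Polynomial.X ^ N := by
    rw [(IsAlgClosed.splits B.charpoly).eq_prod_roots_of_monic B.charpoly_monic, hroots]
    simp
  have := B.aeval_self_charpoly
  rwa [hχ, map_pow, Polynomial.aeval_X] at this

theorem spectrumObstruction_eq_zero_iff {N : ℕ} [NeZero N] (c : ℂ)
    (S : Matrix (Fin N) (Fin N) ℂ) :
    spectrumObstruction c S = 0 ↔ ∀ z ∈ spectrum ℂ S, c * z ∈ spectrum ℂ S := by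
  have hcomp : Polynomial.aeval (c • S) S.charpoly =
      Polynomial.aeval S (S.charpoly.comp (Polynomial.C c * Polynomial.X)) := by
    rw [Polynomial.aeval_comp, map_mul, Polynomial.aeval_C, Polynomial.aeval_X,
      Algebra.algebraMap_eq_smul_one, smul_mul_assoc, one_mul]
  have hspec : spectrum ℂ (Polynomial.aeval (c • S) S.charpoly) =
      (fun z => S.charpoly.eval (c * z)) '' spectrum ℂ S := by
    rw [hcomp, spectrum.map_polynomial_aeval_of_nonempty S _
      (spectrum.nonempty_of_isAlgClosed_of_finiteDimensional ℂ S)]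
    simp
  have hroot : ∀ z, S.charpoly.eval z = 0 ↔ z ∈ spectrum ℂ S := fun z =>
    (Matrix.mem_spectrum_iff_isRoot_charpoly).symm
  constructor
  · intro h z hz
    rw [← hroot]
    have hmem : S.charpoly.eval (c * z) ∈ spectrum ℂ (Polynomial.aeval (c • S) S.charpoly) := by
      rw [hspec]
      exact ⟨z, hz, rfl⟩
    have := spectrum.pow_mem_pow _ N hmem
    rw [spectrumObstruction] at h
    rw [h, spectrum.zero_eq] at this
    exact eq_zero_of_pow_eq_zero this
  · intro h
    refine pow_eq_zero_of_spectrum_subset fun z hz => ?_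
    rw [hspec] at hz
    obtain ⟨y, hy, rfl⟩ := hz
    exact (hroot _).mpr (h y hy)

/-- The entries of `spectrumObstruction c S` are polynomials in the entries of `S`. -/
theorem continuous_spectrumObstruction {N : ℕ} (c : ℂ) :
    Continuous (spectrumObstruction c : Matrix (Fin N) (Fin N) ℂ → Matrix (Fin N) (Fin N) ℂ) := by
  refine continuous_matrix fun i j => ?_
  have h : ∀ S : Matrix (Fin N) (Fin N) ℂ, spectrumObstruction c S i j =
      MvPolynomial.eval (matrixPoint S) (spectrumObstruction (MvPolynomial.C c)
        (Matrix.mvPolynomialX (Fin N) (Fin N) ℂ) i j) := by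
    intro S
    have hS : (Matrix.mvPolynomialX (Fin N) (Fin N) ℂ).map
        (MvPolynomial.eval (matrixPoint S)) = S := by
      ext i j
      simp [matrixPoint]
    have := spectrumObstruction_map (MvPolynomial.eval (matrixPoint S)) (MvPolynomial.C c)
      (Matrix.mvPolynomialX (Fin N) (Fin N) ℂ)
    rw [hS, MvPolynomial.eval_C] at this
    rw [← this, Matrix.map_apply]
  simp_rw [h]
  exact (MvPolynomial.continuous_eval _).comp
    (continuous_pi fun p => continuous_id.matrix_elem p.1 p.2)

/-! ### Degeneration of a space of matrices under a torus -/

section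

open Filter Topology

/-- The limits, as `t → 0`, of matrices `diag(t ^ w) * f t * diag(t ^ w)⁻¹` with `f t` in the
subspace `H`: the degeneration of `H` under the one-parameter torus with weights `w`. -/
noncomputable def torusDegeneration {N : ℕ} (w : Fin N → ℤ)
    (H : Submodule ℂ (Matrix (Fin N) (Fin N) ℂ)) : Submodule ℂ (Matrix (Fin N) (Fin N) ℂ) where
  carrier := {S | ∃ f : ℂ → Matrix (Fin N) (Fin N) ℂ, (∀ t, f t ∈ H) ∧
    Tendsto (fun t : ℂ => Matrix.of fun i j => t ^ (w i - w j) * f t i j) (𝓝[≠] 0) (𝓝 S)}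
  add_mem' := by
    rintro S S' ⟨f, hf, hS⟩ ⟨f', hf', hS'⟩
    refine ⟨fun t => f t + f' t, fun t => H.add_mem (hf t) (hf' t), (hS.add hS').congr fun t => ?_⟩
    ext i j
    simp [mul_add]
  zero_mem' := ⟨fun _ => 0, fun _ => H.zero_mem, by
    refine tendsto_const_nhds.congr fun t => ?_
    ext i j
    simp⟩
  smul_mem' := by
    rintro a S ⟨f, hf, hS⟩
    refine ⟨fun t => a • f t, fun t => H.smul_mem a (hf t), (hS.const_smul a).congr fun t => ?_⟩
    ext i j
    simp [mul_left_comm]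

/-- The component of a matrix in the positions of weight `k`. -/
noncomputable def weightComponent {N : ℕ} (w : Fin N → ℤ) (k : ℤ) :
    Matrix (Fin N) (Fin N) ℂ →ₗ[ℂ] Matrix (Fin N) (Fin N) ℂ where
  toFun S := Matrix.of fun i j => if w i - w j = k then S i j else 0
  map_add' S S' := by
    ext i j
    by_cases h : w i - w j = k <;> simp [h]
  map_smul' a S := by
    ext i j
    by_cases h : w i - w j = k <;> simp [h]

theorem weightComponent_apply {N : ℕ} (w : Fin N → ℤ) (k : ℤ) (S : Matrix (Fin N) (Fin N) ℂ)
    (i j : Fin N) : weightComponent w k S i j = if w i - w j = k then S i j else 0 := rfl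

/-- The members of `H` that have entry zero in all positions of weight less than `k`. -/
def weightFiltration {N : ℕ} (w : Fin N → ℤ) (H : Submodule ℂ (Matrix (Fin N) (Fin N) ℂ)) (k : ℤ) :
    Submodule ℂ (Matrix (Fin N) (Fin N) ℂ) where
  carrier := {S | S ∈ H ∧ ∀ i j, w i - w j < k → S i j = 0}
  add_mem' := by
    rintro S S' ⟨hS, hS0⟩ ⟨hS', hS0'⟩
    exact ⟨H.add_mem hS hS', fun i j h => by simp [hS0 i j h, hS0' i j h]⟩
  zero_mem' := ⟨H.zero_mem, fun _ _ _ => rfl⟩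
  smul_mem' := by
    rintro a S ⟨hS, hS0⟩
    exact ⟨H.smul_mem a hS, fun i j h => by simp [hS0 i j h]⟩

theorem weightComponent_mem_torusDegeneration {N : ℕ} {w : Fin N → ℤ}
    {H : Submodule ℂ (Matrix (Fin N) (Fin N) ℂ)} {k : ℤ} {S : Matrix (Fin N) (Fin N) ℂ}
    (hS : S ∈ weightFiltration w H k) : weightComponent w k S ∈ torusDegeneration w H := by
  refine ⟨fun t => t ^ (-k) • S, fun t => H.smul_mem _ hS.1, ?_⟩
  refine tendsto_pi_nhds.mpr fun i => tendsto_pi_nhds.mpr fun j => ?_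
  have hne : ∀ᶠ t : ℂ in 𝓝[≠] 0, t ≠ 0 := eventually_mem_nhdsWithin
  rcases lt_trichotomy (w i - w j) k with h | h | h
  · have h0 := hS.2 i j h
    simp [weightComponent_apply, h0]
  · rw [weightComponent_apply, if_pos h]
    refine tendsto_const_nhds.congr' ?_
    filter_upwards [hne] with t ht
    simp only [Matrix.of_apply, Matrix.smul_apply, smul_eq_mul, h]
    rw [← mul_assoc, ← zpow_add₀ ht, add_neg_cancel, zpow_zero, one_mul]
  · rw [weightComponent_apply, if_neg h.ne']
    obtain ⟨m, hm⟩ := Int.eq_ofNat_of_zero_le (sub_nonneg.mpr h.le)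
    have hm0 : m ≠ 0 := by omega
    have hlim : Tendsto (fun t : ℂ => t ^ m * S i j) (𝓝[≠] 0) (𝓝 0) := by
      have : Continuous fun t : ℂ => t ^ m * S i j := by fun_prop
      have h2 := this.tendsto 0
      rw [zero_pow hm0, zero_mul] at h2
      exact h2.mono_left nhdsWithin_le_nhds
    refine hlim.congr' ?_
    filter_upwards [hne] with t ht
    simp only [Matrix.of_apply, Matrix.smul_apply, smul_eq_mul]
    rw [← mul_assoc, ← zpow_add₀ ht, ← sub_eq_add_neg, hm]
    exact congrArg (· * S i j) (zpow_natCast t m).symm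

/-- Invariance of the spectrum under multiplication by `c` is a closed condition that does not
change under conjugation, so it passes to the degeneration. -/
theorem mul_mem_spectrum_of_mem_torusDegeneration {N : ℕ} [NeZero N] {w : Fin N → ℤ}
    {H : Submodule ℂ (Matrix (Fin N) (Fin N) ℂ)} {c : ℂ}
    (hH : ∀ S ∈ H, ∀ z ∈ spectrum ℂ S, c * z ∈ spectrum ℂ S)
    {S : Matrix (Fin N) (Fin N) ℂ} (hS : S ∈ torusDegeneration w H) :
    ∀ z ∈ spectrum ℂ S, c * z ∈ spectrum ℂ S := by
  obtain ⟨f, hf, hlim⟩ := hS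
  rw [← spectrumObstruction_eq_zero_iff]
  have hclosed : IsClosed {S : Matrix (Fin N) (Fin N) ℂ | spectrumObstruction c S = 0} :=
    isClosed_eq (continuous_spectrumObstruction c) continuous_const
  refine hclosed.mem_of_tendsto hlim ?_
  filter_upwards [eventually_mem_nhdsWithin (a := (0 : ℂ)) (s := {0}ᶜ)] with t ht
  have ht0 : t ≠ 0 := ht
  change spectrumObstruction c _ = 0
  rw [spectrumObstruction_eq_zero_iff]
  let u : (Matrix (Fin N) (Fin N) ℂ)ˣ :=
    { val := Matrix.diagonal fun i => t ^ w i
      inv := Matrix.diagonal fun i => t ^ (-w i)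
      val_inv := by
        rw [Matrix.diagonal_mul_diagonal, ← Matrix.diagonal_one]
        congr 1
        funext i
        rw [← zpow_add₀ ht0, add_neg_cancel, zpow_zero]
      inv_val := by
        rw [Matrix.diagonal_mul_diagonal, ← Matrix.diagonal_one]
        congr 1
        funext i
        rw [← zpow_add₀ ht0, neg_add_cancel, zpow_zero] }
  have hconj : (Matrix.of fun i j => t ^ (w i - w j) * f t i j) =
      (u : Matrix (Fin N) (Fin N) ℂ) * f t * (u⁻¹ : (Matrix (Fin N) (Fin N) ℂ)ˣ) := by
    ext i j
    change _ = (Matrix.diagonal (fun i => t ^ w i) * f t * Matrix.diagonal fun i => t ^ (-w i)) i j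
    rw [Matrix.mul_diagonal, Matrix.diagonal_mul, Matrix.of_apply, sub_eq_add_neg,
      zpow_add₀ ht0]
    ring
  rw [hconj, spectrum.units_conjugate]
  exact hH _ (hf t)

end

/-! ### Dimension of the degeneration -/

/-- Rank-nullity for the weight component on a step of the filtration. -/
theorem finrank_weightFiltration_le {N : ℕ} (w : Fin N → ℤ)
    (H : Submodule ℂ (Matrix (Fin N) (Fin N) ℂ)) (k : ℤ) :
    Module.finrank ℂ (weightFiltration w H k) ≤
      Module.finrank ℂ ((weightFiltration w H k).map (weightComponent w k)) +
        Module.finrank ℂ (weightFiltration w H (k + 1)) := by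
  have h := LinearMap.finrank_range_add_finrank_ker
    ((weightComponent w k).domRestrict (weightFiltration w H k))
  rw [LinearMap.range_domRestrict] at h
  rw [← h]
  gcongr
  rw [← Submodule.finrank_map_subtype_eq]
  refine Submodule.finrank_mono ?_
  rintro _ ⟨S, hS, rfl⟩
  refine ⟨S.2.1, fun i j hij => ?_⟩
  rcases (Int.lt_add_one_iff.mp hij).lt_or_eq with h | h
  · exact S.2.2 i j h
  · have h0 : weightComponent w k S.1 = 0 := hS
    have := congrFun (congrFun h0 i) j
    rwa [weightComponent_apply, if_pos h] at this

theorem two_pow_add_two_pow_inj {a b c d : ℕ} (h : 2 ^ a + 2 ^ b = 2 ^ c + 2 ^ d) :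
    a = c ∧ b = d ∨ a = d ∧ b = c := by
  have key : ∀ {a b c d : ℕ}, a ≤ b → c ≤ d → 2 ^ a + 2 ^ b = 2 ^ c + 2 ^ d → b ≤ d := by
    intro a b c d _ hcd h
    by_contra hbd
    have h1 : 2 ^ (d + 1) ≤ 2 ^ b := Nat.pow_le_pow_right two_pos (by omega)
    have h2 : 2 ^ c ≤ 2 ^ d := Nat.pow_le_pow_right two_pos hcd
    have h3 : 0 < 2 ^ a := Nat.two_pow_pos a
    rw [pow_succ] at h1
    omega
  have main : ∀ {a b c d : ℕ}, a ≤ b → c ≤ d → 2 ^ a + 2 ^ b = 2 ^ c + 2 ^ d →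
      a = c ∧ b = d := by
    intro a b c d hab hcd h
    have hbd : b = d := le_antisymm (key hab hcd h) (key hcd hab h.symm)
    subst hbd
    exact ⟨Nat.pow_right_injective le_rfl (Nat.add_right_cancel h), rfl⟩
  rcases le_total a b with hab | hab <;> rcases le_total c d with hcd | hcd
  · exact Or.inl (main hab hcd h)
  · exact Or.inr (main hab hcd (by omega))
  · exact Or.inr (main hab hcd (by omega)).symm
  · exact Or.inl (main hab hcd (by omega)).symm

/-- Weights for which no two off-diagonal positions of a matrix have the same weight, and none has
weight zero. -/
def binaryWeight {N : ℕ} (i : Fin N) : ℤ := 2 ^ (i : ℕ)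

theorem binaryWeight_sub_inj {N : ℕ} {i j k l : Fin N} (hij : i ≠ j)
    (h : binaryWeight i - binaryWeight j = binaryWeight k - binaryWeight l) : k = i ∧ l = j := by
  have h' : 2 ^ (i : ℕ) + 2 ^ (l : ℕ) = 2 ^ (k : ℕ) + 2 ^ (j : ℕ) := by
    have : (2 : ℤ) ^ (i : ℕ) + 2 ^ (l : ℕ) = 2 ^ (k : ℕ) + 2 ^ (j : ℕ) := by
      unfold binaryWeight at h
      linarith
    exact_mod_cast this
  rcases two_pow_add_two_pow_inj h' with ⟨h1, h2⟩ | ⟨h1, -⟩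
  · exact ⟨Fin.ext h1.symm, Fin.ext h2⟩
  · exact absurd (Fin.ext h1) hij

theorem binaryWeight_sub_eq_zero_iff {N : ℕ} {i j : Fin N} :
    binaryWeight i - binaryWeight j = 0 ↔ i = j := by
  refine ⟨fun h => ?_, fun h => by rw [h, sub_self]⟩
  by_contra hij
  exact hij ((binaryWeight_sub_inj hij (h.trans (sub_self (binaryWeight i)).symm)).2)

theorem abs_binaryWeight_sub_lt {N : ℕ} (i j : Fin N) :
    |binaryWeight i - binaryWeight j| < 2 ^ N := by
  have h : ∀ i : Fin N, 0 < binaryWeight i ∧ binaryWeight i ≤ 2 ^ N := fun i =>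
    ⟨by unfold binaryWeight; positivity, pow_le_pow_right₀ (by norm_num) i.2.le⟩
  have hi := h i
  have hj := h j
  rw [abs_lt]
  constructor <;> linarith

/-- The off-diagonal positions whose matrix units lie in the degeneration of `H`. -/
noncomputable def degenerationArcs {N : ℕ} (H : Submodule ℂ (Matrix (Fin N) (Fin N) ℂ)) :
    Finset (Fin N × Fin N) :=
  open scoped Classical in
  {p | p.1 ≠ p.2 ∧ Matrix.single p.1 p.2 1 ∈ torusDegeneration binaryWeight H}

/-- The diagonals of the diagonal matrices in the degeneration of `H`. -/
noncomputable def degenerationDiagonals {N : ℕ} (H : Submodule ℂ (Matrix (Fin N) (Fin N) ℂ)) :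
    Submodule ℂ (Fin N → ℂ) :=
  (torusDegeneration binaryWeight H).comap (Matrix.diagonalLinearMap (Fin N) ℂ ℂ)

theorem finrank_map_weightComponent_zero_le {N : ℕ}
    (H : Submodule ℂ (Matrix (Fin N) (Fin N) ℂ)) :
    Module.finrank ℂ ((weightFiltration binaryWeight H 0).map (weightComponent binaryWeight 0)) ≤
      Module.finrank ℂ (degenerationDiagonals H) := by
  refine le_trans (Submodule.finrank_mono ?_)
    (Submodule.finrank_map_le (Matrix.diagonalLinearMap (Fin N) ℂ ℂ) (degenerationDiagonals H))
  rintro _ ⟨S, hS, rfl⟩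
  have hdiag : Matrix.diagonal (fun i => S i i) = weightComponent binaryWeight 0 S := by
    ext i j
    rw [weightComponent_apply, Matrix.diagonal_apply]
    by_cases hij : i = j
    · simp [hij]
    · simp [hij, binaryWeight_sub_eq_zero_iff]
  refine ⟨fun i => S i i, ?_, hdiag⟩
  change Matrix.diagonal (fun i => S i i) ∈ torusDegeneration binaryWeight H
  rw [hdiag]
  exact weightComponent_mem_torusDegeneration hS

theorem finrank_map_weightComponent_le {N : ℕ}
    (H : Submodule ℂ (Matrix (Fin N) (Fin N) ℂ)) {k : ℤ} (hk : k ≠ 0) :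
    Module.finrank ℂ ((weightFiltration binaryWeight H k).map (weightComponent binaryWeight k)) ≤
      ((degenerationArcs H).filter fun p => binaryWeight p.1 - binaryWeight p.2 = k).card := by
  classical
  by_cases hbot : (weightFiltration binaryWeight H k).map (weightComponent binaryWeight k) = ⊥
  · rw [hbot, finrank_bot]
    exact Nat.zero_le _
  obtain ⟨_, ⟨S, hS, rfl⟩, hS0⟩ := Submodule.exists_mem_ne_zero_of_ne_bot hbot
  obtain ⟨i, j, hij⟩ : ∃ i j, weightComponent binaryWeight k S i j ≠ 0 := by
    by_contra! h
    exact hS0 (Matrix.ext h)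
  have hw : binaryWeight i - binaryWeight j = k := by
    by_contra h
    rw [weightComponent_apply, if_neg h] at hij
    exact hij rfl
  rw [weightComponent_apply, if_pos hw] at hij
  have hne : i ≠ j := fun h => hk (by rw [← hw, h, sub_self])
  have hcomp : ∀ S', weightComponent binaryWeight k S' = S' i j • Matrix.single i j 1 := by
    intro S'
    ext a b
    rw [weightComponent_apply, Matrix.smul_apply, Matrix.single_apply]
    by_cases hab : binaryWeight a - binaryWeight b = k
    · obtain ⟨rfl, rfl⟩ := binaryWeight_sub_inj hne (hw.trans hab.symm)
      simp [hw]
    · rw [if_neg hab, if_neg, smul_zero]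
      rintro ⟨rfl, rfl⟩
      exact hab hw
  have harc : (i, j) ∈ degenerationArcs H := by
    have h := weightComponent_mem_torusDegeneration hS
    rw [hcomp, Submodule.smul_mem_iff _ hij] at h
    simp [degenerationArcs, hne, h]
  have h1 : Module.finrank ℂ
      ((weightFiltration binaryWeight H k).map (weightComponent binaryWeight k)) ≤ 1 := by
    refine le_trans (Submodule.finrank_mono (t := Submodule.span ℂ {Matrix.single i j 1}) ?_)
      ((finrank_span_le_card _).trans (by simp))
    rintro _ ⟨S', -, rfl⟩
    rw [hcomp]
    exact Submodule.smul_mem _ _ (Submodule.mem_span_singleton_self _)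
  exact h1.trans (Finset.card_pos.mpr ⟨(i, j), Finset.mem_filter.mpr ⟨harc, hw⟩⟩)

/-- The degeneration of `H` contains enough matrix units and diagonal matrices to fill the dimension
of `H`. -/
theorem finrank_le_card_degenerationArcs_add {N : ℕ}
    (H : Submodule ℂ (Matrix (Fin N) (Fin N) ℂ)) :
    Module.finrank ℂ H ≤
      (degenerationArcs H).card + Module.finrank ℂ (degenerationDiagonals H) := by
  classical
  let a : ℤ → ℕ := fun k => (if k = 0 then Module.finrank ℂ (degenerationDiagonals H) else 0) +
    ((degenerationArcs H).filter fun p => binaryWeight p.1 - binaryWeight p.2 = k).card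
  have ha : ∀ k, Module.finrank ℂ ((weightFiltration binaryWeight H k).map
      (weightComponent binaryWeight k)) ≤ a k := by
    intro k
    by_cases hk : k = 0
    · subst hk
      exact (finrank_map_weightComponent_zero_le H).trans (by simp [a])
    · exact (finrank_map_weightComponent_le H hk).trans (by simp [a])
  have hstep : ∀ n : ℕ, Module.finrank ℂ (weightFiltration binaryWeight H (-2 ^ N)) ≤
      ∑ m ∈ Finset.range n, a (-2 ^ N + m) +
        Module.finrank ℂ (weightFiltration binaryWeight H (-2 ^ N + n)) := by
    intro n
    induction n with
    | zero => rw [Finset.sum_range_zero, Nat.cast_zero, add_zero, zero_add]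
    | succ n ih =>
      refine ih.trans ?_
      have h := finrank_weightFiltration_le binaryWeight H (-2 ^ N + n)
      have h2 := ha (-2 ^ N + n)
      have e : (-2 ^ N + (n + 1 : ℕ) : ℤ) = -2 ^ N + n + 1 := by rw [Nat.cast_succ, add_assoc]
      rw [Finset.sum_range_succ, e]
      omega
  have hbot : weightFiltration binaryWeight H (-2 ^ N + (2 * 2 ^ N : ℕ)) = ⊥ := by
    rw [eq_bot_iff]
    intro S hS
    refine Matrix.ext fun i j => hS.2 i j ?_
    have := (abs_lt.mp (abs_binaryWeight_sub_lt i j)).2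
    push_cast
    linarith
  have htop : H ≤ weightFiltration binaryWeight H (-2 ^ N) := fun S hS =>
    ⟨hS, fun i j hij => absurd hij (abs_lt.mp (abs_binaryWeight_sub_lt i j)).1.not_gt⟩
  have hsum : ∑ m ∈ Finset.range (2 * 2 ^ N), a (-2 ^ N + m) ≤
      Module.finrank ℂ (degenerationDiagonals H) + (degenerationArcs H).card := by
    rw [Finset.sum_add_distrib]
    refine add_le_add ?_ ?_
    · have : ∀ m : ℕ, ((-2 ^ N + m : ℤ) = 0 ↔ m = 2 ^ N) := fun m => by
        rw [neg_add_eq_zero, eq_comm]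
        exact_mod_cast Iff.rfl
      simp_rw [this, Finset.sum_ite_eq']
      split_ifs <;> simp
    · rw [← Finset.card_biUnion]
      · refine Finset.card_le_card fun p hp => ?_
        obtain ⟨m, -, hm⟩ := Finset.mem_biUnion.mp hp
        exact (Finset.mem_filter.mp hm).1
      · intro m _ m' _ hmm'
        rw [Function.onFun, Finset.disjoint_left]
        intro p hp hp'
        have h1 := (Finset.mem_filter.mp hp).2
        have h2 := (Finset.mem_filter.mp hp').2
        omega
  have h := hstep (2 * 2 ^ N)
  rw [hbot, finrank_bot] at h
  have h2 := Submodule.finrank_mono htop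
  omega

/-! ### Directed graphs without a short detour around a double arc -/

/-- A directed graph with more than `n² / 2` arcs contains two opposite arcs `i ⇄ j` together with
a path `i → k → j`. The induction removes such a pair: every other vertex is joined to it by at
most two arcs. -/
theorem two_mul_sum_le_card_sq_of_path_free {ι : Type*} [DecidableEq ι] (r : ι → ι → Prop)
    [DecidableRel r] (hirr : ∀ i, ¬ r i i)
    (hfree : ∀ i j k, r i j → r j i → r i k → ¬ r k j) (V : Finset ι) :
    2 * ∑ x ∈ V, ∑ y ∈ V, (if r x y then 1 else 0) ≤ V.card ^ 2 := by
  induction V using Finset.strongInduction with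
  | H V ih =>
  by_cases hpair : ∃ i ∈ V, ∃ j ∈ V, r i j ∧ r j i
  · obtain ⟨i, hi, j, hj, hij, hji⟩ := hpair
    have hne : i ≠ j := fun h => hirr i (h ▸ hij)
    let W := (V.erase i).erase j
    have hjW : j ∉ W := Finset.notMem_erase _ _
    have hVi : insert j W = V.erase i :=
      Finset.insert_erase (Finset.mem_erase.mpr ⟨hne.symm, hj⟩)
    have hiW : i ∉ insert j W := by
      rw [hVi]
      exact Finset.notMem_erase _ _
    have hV : V = insert i (insert j W) := by rw [hVi, Finset.insert_erase hi]
    have hWV : W ⊂ V := Finset.ssubset_iff_subset_ne.mpr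
      ⟨(Finset.erase_subset _ _).trans (Finset.erase_subset _ _), fun h => hjW (h ▸ hj)⟩
    have hW := ih W hWV
    have hcard : V.card = W.card + 2 := by
      rw [hV, Finset.card_insert_of_notMem hiW, Finset.card_insert_of_notMem hjW]
    have hk : ∀ k ∈ W, (if r i k then 1 else 0) + (if r j k then 1 else 0) +
        ((if r k i then 1 else 0) + (if r k j then 1 else 0)) ≤ 2 := by
      intro k _
      have h1 := hfree i j k hij hji
      have h2 := hfree j i k hji hij
      split_ifs <;> first
        | exact absurd ‹r k j› (h1 ‹_›)
        | exact absurd ‹r k i› (h2 ‹_›)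
        | omega
    have hsum := Finset.sum_le_sum hk
    simp only [Finset.sum_add_distrib, Finset.sum_const, smul_eq_mul] at hsum
    rw [hV]
    simp only [Finset.sum_insert hiW, Finset.sum_insert hjW, Finset.sum_add_distrib, if_pos hij,
      if_pos hji, if_neg (hirr i), if_neg (hirr j)]
    rw [← hV, hcard]
    nlinarith
  -- Without opposite arcs, each unordered pair carries at most one.
  · have hle : ∀ x ∈ V, ∀ y ∈ V, (if r x y then 1 else 0) + (if r y x then 1 else 0) ≤ 1 := by
      intro x hx y hy
      have : ¬ (r x y ∧ r y x) := fun h => hpair ⟨x, hx, y, hy, h⟩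
      split_ifs with h1 h2
      · exact absurd ⟨h1, h2⟩ this
      all_goals omega
    have h := Finset.sum_le_sum fun x hx => Finset.sum_le_sum fun y hy => hle x hx y hy
    simp only [Finset.sum_add_distrib, Finset.sum_const, smul_eq_mul, mul_one] at h
    rw [Finset.sum_comm (f := fun x y => if r y x then 1 else 0)] at h
    rw [sq]
    omega

/-! ### Spaces of matrices with spectrum invariant under a scalar -/

theorem Matrix.mem_spectrum_iff_exists_mulVec {N : ℕ} {S : Matrix (Fin N) (Fin N) ℂ} {z : ℂ} :
    z ∈ spectrum ℂ S ↔ ∃ v ≠ 0, S.mulVec v = z • v := by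
  rw [spectrum.mem_iff, Matrix.isUnit_iff_isUnit_det, isUnit_iff_ne_zero, not_not,
    ← Matrix.exists_mulVec_eq_zero_iff]
  refine exists_congr fun v => and_congr_right fun _ => ?_
  rw [Matrix.sub_mulVec, sub_eq_zero, Algebra.algebraMap_eq_smul_one, Matrix.smul_mulVec,
    Matrix.one_mulVec, eq_comm]

set_option linter.unusedSimpArgs false in
/-- Four matrix units on a `3`-cycle with one arc doubled combine to a matrix whose nonzero
eigenvalues are the roots `1` and `-2` of `x³ - 3 x + 2`. -/
theorem exists_mul_notMem_spectrum_of_single_mem {N : ℕ}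
    {L : Submodule ℂ (Matrix (Fin N) (Fin N) ℂ)} {i j k : Fin N} (hij : i ≠ j) (hik : i ≠ k)
    (hkj : k ≠ j) (h1 : Matrix.single i j 1 ∈ L) (h2 : Matrix.single j i 1 ∈ L)
    (h3 : Matrix.single i k 1 ∈ L) (h4 : Matrix.single k j 1 ∈ L)
    {c : ℂ} (hc0 : c ≠ 0) (hc1 : c ≠ 1) :
    ∃ S ∈ L, ∃ z ∈ spectrum ℂ S, c * z ∉ spectrum ℂ S := by
  let S : Matrix (Fin N) (Fin N) ℂ := (3 : ℂ) • Matrix.single i j 1 + Matrix.single j i 1 +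
    (-2 : ℂ) • Matrix.single i k 1 + Matrix.single k j 1
  have hSL : S ∈ L :=
    L.add_mem (L.add_mem (L.add_mem (L.smul_mem _ h1) h2) (L.smul_mem _ h3)) h4
  have hS : ∀ v l, S.mulVec v l = (if l = i then 3 * v j - 2 * v k else 0) +
      (if l = j then v i else 0) + (if l = k then v j else 0) := by
    intro v l
    simp only [S, Matrix.add_mulVec, Matrix.smul_mulVec, Matrix.single_mulVec, Pi.add_apply,
      Pi.smul_apply, Function.update_apply, smul_eq_mul, one_mul, Pi.zero_apply]
    split_ifs <;> ring
  have hspec : ∀ z ∈ spectrum ℂ S, z = 0 ∨ z = 1 ∨ z = -2 := by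
    intro z hz
    obtain ⟨v, hv, hSv⟩ := Matrix.mem_spectrum_iff_exists_mulVec.mp hz
    by_contra! hcon
    obtain ⟨hz0, hz1, hz2⟩ := hcon
    have hl : ∀ l, S.mulVec v l = z * v l := fun l => congrFun hSv l
    have ei := hl i
    have ej := hl j
    have ek := hl k
    simp only [hS, hij, hij.symm, hik, hik.symm, hkj, hkj.symm, if_true, if_false, add_zero,
      zero_add] at ei ej ek
    have hvk : v k = 0 := by
      have h0 : (z - 1) * (z - 1) * (z + 2) * v k = 0 := by
        -- With `v k` as parameter, `v j = z v k` and `v i = z² v k`.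
        rw [ej, ek] at ei
        linear_combination (-1 : ℂ) * ei
      have hz2' : z + 2 ≠ 0 := fun h => hz2 (eq_neg_of_add_eq_zero_left h)
      exact (mul_eq_zero.mp h0).resolve_left
        (mul_ne_zero (mul_ne_zero (sub_ne_zero.mpr hz1) (sub_ne_zero.mpr hz1)) hz2')
    have hvj : v j = 0 := by rw [ek, hvk, mul_zero]
    have hvi : v i = 0 := by rw [ej, hvj, mul_zero]
    refine hv (funext fun l => ?_)
    have el := hl l
    rw [hS, hvi, hvj, hvk] at el
    simp only [mul_zero, sub_zero, ite_self, add_zero] at el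
    exact (mul_eq_zero.mp el.symm).resolve_left hz0
  have hone : (1 : ℂ) ∈ spectrum ℂ S := by
    refine Matrix.mem_spectrum_iff_exists_mulVec.mpr
      ⟨fun l => if l = i then 1 else if l = j then 1 else if l = k then 1 else 0,
        fun h => by simpa using congrFun h i, ?_⟩
    funext l
    rw [hS]
    by_cases hli : l = i
    · subst hli; simp [hij, hij.symm, hik, hik.symm, hkj, hkj.symm]; norm_num
    by_cases hlj : l = j
    · subst hlj; simp [hij, hij.symm, hik, hik.symm, hkj, hkj.symm]
    by_cases hlk : l = k
    · subst hlk; simp [hij, hij.symm, hik, hik.symm, hkj, hkj.symm]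
    simp [hli, hlj, hlk]
  have htwo : (-2 : ℂ) ∈ spectrum ℂ S := by
    refine Matrix.mem_spectrum_iff_exists_mulVec.mpr
      ⟨fun l => if l = i then 4 else if l = j then -2 else if l = k then 1 else 0,
        fun h => by simpa using congrFun h i, ?_⟩
    funext l
    rw [hS]
    by_cases hli : l = i
    · subst hli; simp [hij, hij.symm, hik, hik.symm, hkj, hkj.symm]; norm_num
    by_cases hlj : l = j
    · subst hlj; simp [hij, hij.symm, hik, hik.symm, hkj, hkj.symm]; norm_num
    by_cases hlk : l = k
    · subst hlk; simp [hij, hij.symm, hik, hik.symm, hkj, hkj.symm]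
    simp [hli, hlj, hlk]
  refine ⟨S, hSL, ?_⟩
  by_contra! hstable
  rcases hspec _ (hstable 1 hone) with h | h | h
  · exact hc0 (by simpa using h)
  · exact hc1 (by simpa using h)
  · have hc : c = -2 := by simpa using h
    subst hc
    rcases hspec _ (hstable (-2) htwo) with h | h | h <;> norm_num at h

theorem Matrix.mem_spectrum_diagonal_iff {N : ℕ} {d : Fin N → ℂ} {z : ℂ} :
    z ∈ spectrum ℂ (Matrix.diagonal d) ↔ ∃ i, d i = z := by
  rw [spectrum_diagonal]; rfl

/-- If multiplication by `c ≠ 0, 1` preserves the set of entries of every vector in `D`, then each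
coordinate functional on `D` has `c` times itself among the others. A basis of the dual of `D`
formed of coordinates and its multiple by `c` then use different coordinates. -/
theorem two_mul_finrank_le_of_mul_mem_range {N : ℕ} {D : Submodule ℂ (Fin N → ℂ)} {c : ℂ}
    (hc0 : c ≠ 0) (hc1 : c ≠ 1) (hD : ∀ d ∈ D, ∀ i, ∃ j, d j = c * d i) :
    2 * Module.finrank ℂ D ≤ N := by
  let x : Fin N → Module.Dual ℂ D := fun i => (LinearMap.proj i).comp D.subtype
  have hσ : ∀ i, ∃ j, x j = c • x i := by
    intro i
    have hcover : ⋃ j, ((LinearMap.ker (x j - c • x i) : Submodule ℂ D) : Set D) = Set.univ := by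
      rw [Set.eq_univ_iff_forall]
      intro d
      obtain ⟨j, hj⟩ := hD d.1 d.2 i
      rw [Set.mem_iUnion]
      refine ⟨j, ?_⟩
      change (x j - c • x i) d = 0
      rw [LinearMap.sub_apply, sub_eq_zero]
      exact hj
    obtain ⟨j, hj⟩ := Subspace.exists_eq_top_of_iUnion_eq_univ hcover
    exact ⟨j, sub_eq_zero.mp (LinearMap.ker_eq_top.mp hj)⟩
  choose σ hσ using hσ
  obtain ⟨κ, a, ha, hspan, hli⟩ := exists_linearIndependent' ℂ x
  have : Finite κ := Finite.of_injective a ha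
  have := Fintype.ofFinite κ
  have hfin : Module.finrank ℂ D ≤ Fintype.card κ := by
    rw [← Module.finrank_fintype_fun_eq_card ℂ (η := κ)]
    refine LinearMap.finrank_le_finrank_of_injective (f := LinearMap.pi (x ∘ a)) ?_
    rw [injective_iff_map_eq_zero]
    intro d hd
    have hle : Submodule.span ℂ (Set.range (x ∘ a)) ≤
        LinearMap.ker (Module.Dual.eval ℂ D d) := by
      rw [Submodule.span_le]
      rintro _ ⟨p, rfl⟩
      exact congrFun hd p
    refine Subtype.ext (funext fun i => ?_)
    rw [hspan] at hle
    exact hle (Submodule.subset_span ⟨i, rfl⟩)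
  have hinj : Function.Injective (Sum.elim a (σ ∘ a)) := by
    refine Function.Injective.sumElim ha ?_ ?_
    · intro p q hpq
      have h : c • x (a p) = c • x (a q) := by
        rw [← hσ, ← hσ]
        exact congrArg x hpq
      exact hli.injective (smul_right_injective _ hc0 h)
    · intro p q hpq
      have h : x (a p) = c • x (a q) := by
        rw [← hσ]
        exact congrArg x hpq
      classical
      -- Also for `p = q` the coefficient at `p` is not zero: it is `1 - c`.
      have h0 := Fintype.linearIndependent_iff.mp hli (Pi.single p 1 - Pi.single q c)
        (by simp [sub_smul, Pi.single_apply, ite_smul, h]) p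
      by_cases hpq' : p = q
      · subst hpq'
        simp only [Pi.sub_apply, Pi.single_eq_same] at h0
        exact hc1 (sub_eq_zero.mp h0).symm
      · simp [hpq'] at h0
  have := Fintype.card_le_of_injective _ hinj
  rw [Fintype.card_sum, Fintype.card_fin] at this
  omega

/-- A subspace of dimension more than `N (N + 1) / 2` contains, for every `c ≠ 0, 1`, a matrix
whose spectrum is not preserved by `c`. Otherwise its degeneration would have at most `N / 2`
independent diagonal matrices and at most `N² / 2` off-diagonal matrix units. -/
theorem exists_mul_notMem_spectrum {N : ℕ} [NeZero N]
    {H : Submodule ℂ (Matrix (Fin N) (Fin N) ℂ)} (hH : N * (N + 1) / 2 < Module.finrank ℂ H)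
    {c : ℂ} (hc0 : c ≠ 0) (hc1 : c ≠ 1) :
    ∃ S ∈ H, ∃ z ∈ spectrum ℂ S, c * z ∉ spectrum ℂ S := by
  by_contra! hstable
  have hL : ∀ S ∈ torusDegeneration binaryWeight H, ∀ z ∈ spectrum ℂ S, c * z ∈ spectrum ℂ S :=
    fun S hS => mul_mem_spectrum_of_mem_torusDegeneration hstable hS
  have hdiag : 2 * Module.finrank ℂ (degenerationDiagonals H) ≤ N := by
    refine two_mul_finrank_le_of_mul_mem_range hc0 hc1 fun d hd i => ?_
    exact Matrix.mem_spectrum_diagonal_iff.mp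
      (hL _ hd (d i) (Matrix.mem_spectrum_diagonal_iff.mpr ⟨i, rfl⟩))
  have harcs : 2 * (degenerationArcs H).card ≤ N ^ 2 := by
    classical
    have hmem : ∀ {i j}, (i, j) ∈ degenerationArcs H ↔
        i ≠ j ∧ Matrix.single i j 1 ∈ torusDegeneration binaryWeight H := by
      simp [degenerationArcs]
    have h := two_mul_sum_le_card_sq_of_path_free (fun i j => (i, j) ∈ degenerationArcs H)
      (fun i h => (hmem.mp h).1 rfl) (fun i j k hij hji hik hkj => by
        obtain ⟨S, hS, z, hz, hcz⟩ := exists_mul_notMem_spectrum_of_single_mem (hmem.mp hij).1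
          (hmem.mp hik).1 (hmem.mp hkj).1 (hmem.mp hij).2 (hmem.mp hji).2 (hmem.mp hik).2
          (hmem.mp hkj).2 hc0 hc1
        exact hcz (hL S hS z hz)) Finset.univ
    rw [← Fintype.sum_prod_type'
      (f := fun i j => if (i, j) ∈ degenerationArcs H then 1 else 0)] at h
    simpa using h
  have hdim := finrank_le_card_degenerationArcs_add H
  have heven : 2 * (N * (N + 1) / 2) = N * (N + 1) :=
    Nat.mul_div_cancel' (Nat.even_mul_succ_self N).two_dvd
  nlinarith

/-- If `c ≠ 0` maps the spectrum into itself and some eigenvalue `z` is not zero, then `c` is a root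
of unity of order at most `N`, as `z, c z, …, c ^ N z` cannot be distinct eigenvalues. -/
theorem pow_factorial_eq_one_of_mul_mem_spectrum {N : ℕ} {S : Matrix (Fin N) (Fin N) ℂ} {c z : ℂ}
    (hc0 : c ≠ 0) (hS : ∀ z ∈ spectrum ℂ S, c * z ∈ spectrum ℂ S) (hz : z ∈ spectrum ℂ S)
    (hz0 : z ≠ 0) : c ^ N.factorial = 1 := by
  have hmem : ∀ n : ℕ, c ^ n * z ∈ spectrum ℂ S := by
    intro n
    induction n with
    | zero => simpa using hz
    | succ n ih =>
      have := hS _ ih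
      rwa [← mul_assoc, ← pow_succ'] at this
  have hcard : S.charpoly.roots.toFinset.card < (Finset.range (N + 1)).card := by
    have h1 := S.charpoly.roots.toFinset_card_le
    have h2 := S.charpoly.card_roots'
    rw [Matrix.charpoly_natDegree_eq_dim, Fintype.card_fin] at h2
    rw [Finset.card_range]
    omega
  obtain ⟨a, ha, b, hb, hab, heq⟩ := Finset.exists_ne_map_eq_of_card_lt_of_maps_to hcard
    (f := fun n => c ^ n * z) (fun n _ => Finset.mem_coe.mpr <| Multiset.mem_toFinset.mpr <|
      (Polynomial.mem_roots S.charpoly_monic.ne_zero).mpr <|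
        Matrix.mem_spectrum_iff_isRoot_charpoly.mp (hmem n))
  have hab' := mul_right_cancel₀ hz0 heq
  have key : ∀ a b : ℕ, a < b → b < N + 1 → c ^ a = c ^ b → c ^ N.factorial = 1 := by
    intro a b hlt hb h
    have h1 : c ^ (b - a) = 1 := by
      refine mul_left_cancel₀ (pow_ne_zero a hc0) ?_
      rw [← pow_add, Nat.add_sub_cancel' hlt.le, mul_one, h]
    obtain ⟨m, hm⟩ := Nat.dvd_factorial (Nat.sub_pos_of_lt hlt) (show b - a ≤ N by omega)
    rw [hm, pow_mul, h1, one_pow]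
  rcases hab.lt_or_gt with h | h
  · exact key a b h (Finset.mem_range.mp hb) hab'
  · exact key b a h (Finset.mem_range.mp ha) hab'.symm

/-- If the spectrum of one matrix in the image of `f` is not preserved by `c`, then the same holds
outside the zero set of a nonzero polynomial in the coordinates. -/
theorem exists_polynomial_of_exists_mul_notMem_spectrum {N n : ℕ} [NeZero N]
    {E : Type*} [AddCommGroup E] [Module ℂ E] (b : Module.Basis (Fin n) ℂ E)
    (f : E →ₗ[ℂ] Matrix (Fin N) (Fin N) ℂ) {c : ℂ}
    (hc : ∃ e, ∃ z ∈ spectrum ℂ (f e), c * z ∉ spectrum ℂ (f e)) :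
    ∃ g : MvPolynomial (Fin n) ℂ, g ≠ 0 ∧ ∀ x, MvPolynomial.eval x g ≠ 0 →
      ∃ z ∈ spectrum ℂ (f (b.equivFun.symm x)), c * z ∉ spectrum ℂ (f (b.equivFun.symm x)) := by
  let G : Matrix (Fin N) (Fin N) (MvPolynomial (Fin n) ℂ) :=
    Matrix.of fun i j => ∑ l, MvPolynomial.X l * MvPolynomial.C (f (b l) i j)
  have hG : ∀ x, G.map (MvPolynomial.eval x) = f (b.equivFun.symm x) := by
    intro x
    ext i j
    simp [G, Module.Basis.equivFun_symm_apply, Matrix.sum_apply]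
  have hP : ∀ x, (spectrumObstruction (MvPolynomial.C c) G).map (MvPolynomial.eval x) =
      spectrumObstruction c (f (b.equivFun.symm x)) := by
    intro x
    rw [spectrumObstruction_map, hG, MvPolynomial.eval_C]
  have hne : spectrumObstruction (MvPolynomial.C c) G ≠ 0 := by
    intro h
    obtain ⟨e, z, hz, hcz⟩ := hc
    have h1 := hP (b.equivFun e)
    rw [h, LinearEquiv.symm_apply_apply, Matrix.map_zero _ (map_zero _)] at h1
    exact hcz ((spectrumObstruction_eq_zero_iff c _).mp h1.symm z hz)
  obtain ⟨i, j, hij⟩ : ∃ i j, spectrumObstruction (MvPolynomial.C c) G i j ≠ 0 := by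
    by_contra! h
    exact hne (Matrix.ext h)
  refine ⟨_, hij, fun x hx => ?_⟩
  by_contra! h
  rw [← spectrumObstruction_eq_zero_iff, ← hP] at h
  exact hx (congrFun (congrFun h i) j)

/-! ### Reduction to the strict inequality, and the generic matrix -/

theorem matrixSetDim_nonneg {N : ℕ} {Aut : Set (Matrix (Fin N) (Fin N) ℂ)} (hne : Aut.Nonempty) :
    0 ≤ matrixSetDim Aut := by
  have : Nontrivial (MvPolynomial (Fin N × Fin N) ℂ ⧸
      MvPolynomial.vanishingIdeal ℂ (matrixPoint '' Aut)) := by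
    refine Ideal.Quotient.nontrivial_iff.mpr fun h => ?_
    obtain ⟨M, hM⟩ := hne
    have h1 : (1 : MvPolynomial (Fin N × Fin N) ℂ) ∈
      MvPolynomial.vanishingIdeal ℂ (matrixPoint '' Aut) := h ▸ Submodule.mem_top
    simpa using h1 _ ⟨M, hM, rfl⟩
  exact ringKrullDim_nonneg_of_nontrivial

/-- Both dimension hypotheses reduce to the strict one. In the scaling-stable case every member of
`Aut` has a multiple of determinant one, which satisfies `S M = M Sᵀ` for the same `S`. -/
theorem exists_subset_matrixSetDim_add_lt {N n : ℕ} (hN : 1 ≤ N)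
    {Aut : Set (Matrix (Fin N) (Fin N) ℂ)}
    (hAut : Aut ⊆ invertibleSymmetric N) (hne : Aut.Nonempty)
    (hdim : matrixSetDim Aut + ((N * (N + 1) / 2 : ℕ) : WithBot ℕ∞) < (n : WithBot ℕ∞) ∨
      (IsScalingStable Aut ∧
        matrixSetDim Aut + ((N * (N + 1) / 2 : ℕ) : WithBot ℕ∞) ≤ (n : WithBot ℕ∞))) :
    ∃ A ⊆ Aut, A.Nonempty ∧
      matrixSetDim A + ((N * (N + 1) / 2 : ℕ) : WithBot ℕ∞) < (n : WithBot ℕ∞) ∧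
      ∀ S : Matrix (Fin N) (Fin N) ℂ, (∃ M ∈ Aut, S * M = M * S.transpose) →
        ∃ M ∈ A, S * M = M * S.transpose := by
  rcases hdim with hdim | ⟨hst, hdim⟩
  · exact ⟨Aut, subset_rfl, hne, hdim, fun S h => h⟩
  have hscale : ∀ M ∈ Aut, ∃ a : ℂ, a • M ∈ {M ∈ Aut | M.det = 1} := by
    intro M hM
    have hdet : M.det ≠ 0 := ((Matrix.isUnit_iff_isUnit_det M).mp (hAut hM).2).ne_zero
    obtain ⟨a, ha⟩ := IsAlgClosed.exists_pow_nat_eq (M.det⁻¹) (show 0 < N by omega)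
    have ha0 : a ≠ 0 := by
      rintro rfl
      rw [zero_pow (by omega)] at ha
      exact inv_ne_zero hdet ha.symm
    refine ⟨a, hst a ha0 M hM, ?_⟩
    rw [Matrix.det_smul, Fintype.card_fin, ha, inv_mul_cancel₀ hdet]
  have hAne : {M ∈ Aut | M.det = 1}.Nonempty := by
    obtain ⟨M, hM⟩ := hne
    obtain ⟨a, ha⟩ := hscale M hM
    exact ⟨_, ha⟩
  refine ⟨{M ∈ Aut | M.det = 1}, fun _ h => h.1, hAne, ?_, ?_⟩
  · have h := matrixSetDim_det_eq_one_add_one_le hN hst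
    have h0 := matrixSetDim_nonneg hAne
    have h2 := (add_le_add_left h _).trans hdim
    generalize matrixSetDim {M ∈ Aut | M.det = 1} = d at h0 h2 ⊢
    lift d to ℕ∞ using (WithBot.bot_lt_coe (0 : ℕ∞)).trans_le h0 |>.ne'
    have h3 : d + 1 + (N * (N + 1) / 2 : ℕ) ≤ (n : ℕ∞) := by exact_mod_cast h2
    have h4 : d + (N * (N + 1) / 2 : ℕ) < (n : ℕ∞) := by
      lift d to ℕ using by
        rintro rfl
        simp at h3
      norm_cast at h3 ⊢
      omega
    exact_mod_cast h4
  · rintro S ⟨M, hM, hSM⟩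
    obtain ⟨a, ha⟩ := hscale M hM
    exact ⟨_, ha, by rw [Matrix.mul_smul, Matrix.smul_mul, hSM]⟩

theorem mainTheorem6 (N : ℕ) (hN : 1 ≤ N)
    (H : Submodule ℂ (Matrix (Fin N) (Fin N) ℂ))
    (Aut : Set (Matrix (Fin N) (Fin N) ℂ))
    (hAut : Aut ⊆ invertibleSymmetric N) (hne : Aut.Nonempty)
    (hdim :
      matrixSetDim Aut + ((N * (N + 1) / 2 : ℕ) : WithBot ℕ∞)
          < ((Module.finrank ℂ H : ℕ) : WithBot ℕ∞) ∨
      (IsScalingStable Aut ∧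
        matrixSetDim Aut + ((N * (N + 1) / 2 : ℕ) : WithBot ℕ∞)
          ≤ ((Module.finrank ℂ H : ℕ) : WithBot ℕ∞))) :
    ∃ S ∈ H,
      (∀ c : ℂ, c ≠ 1 → (fun z : ℂ => c * z) '' spectrum ℂ S ≠ spectrum ℂ S) ∧
      ∀ M ∈ Aut, S * M ≠ M * S.transpose := by
  have : NeZero N := ⟨by omega⟩
  obtain ⟨A, hA, hAne, hAdim, hAAut⟩ := exists_subset_matrixSetDim_add_lt hN hAut hne hdim
  have hH : N * (N + 1) / 2 < Module.finrank ℂ H := by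
    have h0 := matrixSetDim_nonneg hAne
    have : ((N * (N + 1) / 2 : ℕ) : WithBot ℕ∞) < ((Module.finrank ℂ H : ℕ) : WithBot ℕ∞) :=
      lt_of_le_of_lt (by simpa using add_le_add_left h0 _) hAdim
    exact_mod_cast this
  obtain ⟨ρ, hρ⟩ := LinearMap.exists_leftInverse_of_injective H.subtype H.ker_subtype
  let b := Module.finBasis ℂ H
  obtain ⟨Q, hQ0, hQ⟩ := exists_polynomial_vanishing_of_matrixSetDim_lt (hA.trans hAut) hAdim
    (b.equivFun.toLinearMap.comp ρ)
  -- Every `c ≠ 1` that preserves a spectrum containing a nonzero number lies in this finite set. The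
  -- factor `2` puts `-1` into it.
  let C : Finset ℂ := (Polynomial.nthRootsFinset (2 * N.factorial) (1 : ℂ)).erase 1
  have hpos : 0 < 2 * N.factorial := Nat.mul_pos two_pos N.factorial_pos
  have hC : ∀ {c : ℂ}, c ∈ C ↔ c ≠ 1 ∧ c ^ (2 * N.factorial) = 1 := by
    intro c
    rw [Finset.mem_erase, Polynomial.mem_nthRootsFinset hpos]
  have hg : ∀ c ∈ C, ∃ g : MvPolynomial (Fin (Module.finrank ℂ H)) ℂ, g ≠ 0 ∧
      ∀ x, MvPolynomial.eval x g ≠ 0 →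
        ∃ z ∈ spectrum ℂ (H.subtype (b.equivFun.symm x)),
          c * z ∉ spectrum ℂ (H.subtype (b.equivFun.symm x)) := by
    intro c hc
    have hc0 : c ≠ 0 := fun h => by simpa [h, hpos.ne'] using (hC.mp hc).2
    obtain ⟨S, hS, h⟩ := exists_mul_notMem_spectrum hH hc0 (hC.mp hc).1
    exact exists_polynomial_of_exists_mul_notMem_spectrum b H.subtype ⟨⟨S, hS⟩, h⟩
  choose! g hg0 hg using hg
  have hprod : Q * ∏ c ∈ C, g c ≠ 0 := mul_ne_zero hQ0 (Finset.prod_ne_zero_iff.mpr hg0)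
  obtain ⟨x, hx⟩ : ∃ x, MvPolynomial.eval x (Q * ∏ c ∈ C, g c) ≠ 0 := by
    by_contra! h
    exact hprod (MvPolynomial.funext fun x => by rw [h, map_zero])
  rw [map_mul, map_prod] at hx
  have hxQ := left_ne_zero_of_mul hx
  have hxg : ∀ c ∈ C, MvPolynomial.eval x (g c) ≠ 0 :=
    Finset.prod_ne_zero_iff.mp (right_ne_zero_of_mul hx)
  refine ⟨H.subtype (b.equivFun.symm x), (b.equivFun.symm x).2, fun c hc1 himage => ?_,
    fun M hM hSM => ?_⟩
  · have hstable : ∀ z ∈ spectrum ℂ (H.subtype (b.equivFun.symm x)),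
        c * z ∈ spectrum ℂ (H.subtype (b.equivFun.symm x)) := fun z hz => by
      rw [← himage]
      exact ⟨z, hz, rfl⟩
    -- As `-1` does not preserve the spectrum, some eigenvalue is not zero.
    obtain ⟨z, hz, hz'⟩ := hg (-1) (hC.mpr ⟨by norm_num, by simp [pow_mul]⟩)
      x (hxg _ (hC.mpr ⟨by norm_num, by simp [pow_mul]⟩))
    have hz0 : z ≠ 0 := by
      rintro rfl
      exact hz' (by simpa using hz)
    have hc0 : c ≠ 0 := by
      rintro rfl
      rw [← himage] at hz
      obtain ⟨y, -, hy⟩ := hz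
      exact hz0 (by simpa using hy.symm)
    have hpow := pow_factorial_eq_one_of_mul_mem_spectrum hc0 hstable hz hz0
    have hcC : c ∈ C := hC.mpr ⟨hc1, by rw [mul_comm, pow_mul, hpow, one_pow]⟩
    obtain ⟨y, hy, hy'⟩ := hg c hcC x (hxg c hcC)
    exact hy' (hstable y hy)
  · refine hxQ ?_
    have h := hQ (H.subtype (b.equivFun.symm x)) (hAAut _ ⟨M, hM, hSM⟩)
    have hρx : ρ (H.subtype (b.equivFun.symm x)) = b.equivFun.symm x :=
      LinearMap.congr_fun hρ _
    have hbx : b.equivFun.toLinearMap (b.equivFun.symm x) = x := b.equivFun.apply_symm_apply x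
    rwa [LinearMap.comp_apply, hρx, hbx] at h
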